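/- Let $m,n\ge 1$, let $\|\cdot\|_{\mathcal A}$ be a norm on $\mathbb R^n$ with dual norm $\|x\|_{\mathcal A}^*=\sup\{\langle x,a\rangle:\|a\|_{\mathcal A}\le 1\}$, and let $x_0\in\mathbb R^n$. Suppose that $\|\cdot\|_{\mathcal A}$ is decomposable at $x_0$ with subspace $T\subset\mathbb R^n$ and vector $e\in T$; that is, the subdifferential of $\|\cdot\|_{\mathcal A}$ at $x_0$ is $$\partial\|x_0\|_{\mathcal A}=\{z\in\mathbb R^n:\ \mathcal P_T(z)=e\ \text{ and }\ \|\mathcal P_{T^\perp}(z)\|_{\mathcal A}^*\le 1\},$$ and every $w\in T^\perp$ satisfies $\|w\|_{\mathcal A}=\sup\{\langle v,w\rangle: v\in T^\perp,\ \|v\|_{\mathcal A}^*\le 1\}$. Here $\mathcal P_T$ and $\mathcal P_{T^\perp}$ are the orthogonal projections onto $T$ and $T^\perp$. Let $d_T=\dim T$. Let $\Phi$ be a random $m\times n$ matrix with i.i.d. Gaussian entries of mean $0$ and variance $1/m$, let $\Phi_T$ be its restriction to $T$, and put $$q=\Phi_T(\Phi_T^*\Phi_T)^{-1}e,\qquad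 y=\Phi^*q$$ (with $q=0$, say, on the null event that $\Phi_T$ is not injective). Let $0<t<m-d_T+1$ (so that, in particular, $m\ge d_T$). Then $x_0$ is the unique optimal solution of $$\text{minimize }\ \|x\|_{\mathcal A}\quad\text{subject to}\quad \Phi x=\Phi x_0$$ with probability at least $$1-\mathbb P\left[\ \|\mathcal P_{T^\perp}(y)\|_{\mathcal A}^*\ge 1\ \middle|\ \|q\|_2\le\sqrt{\tfrac{m}{m-d_T+1-t}}\,\|e\|_2\ \right]-\exp\left(-\frac{t^2/4}{m-d_T+1}\right).$$ -/

import Mathlib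

open MeasureTheory ProbabilityTheory
open scoped NNReal ENNReal

noncomputable section

/-- The dual norm `‖x‖* = sup {⟨x, a⟩ : ‖a‖ ≤ 1}` of a norm `N` on `ℝⁿ`. (For a norm the supremum
is over a nonempty bounded set.) -/
def dualNorm {n : ℕ} (N : Seminorm ℝ (EuclideanSpace ℝ (Fin n)))
    (x : EuclideanSpace ℝ (Fin n)) : ℝ :=
  sSup {r : ℝ | ∃ a : EuclideanSpace ℝ (Fin n), N a ≤ 1 ∧ r = inner ℝ x a}

/-- The subdifferential of `N` at `x₀`. -/
def subdifferential {n : ℕ} (N : Seminorm ℝ (EuclideanSpace ℝ (Fin n)))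
    (x₀ : EuclideanSpace ℝ (Fin n)) : Set (EuclideanSpace ℝ (Fin n)) :=
  {z | ∀ x, N x₀ + inner ℝ z (x - x₀) ≤ N x}

/-- `N` is decomposable at `x₀`, with subspace `T` and vector `e ∈ T`. -/
structure IsDecomposableAt {n : ℕ} (N : Seminorm ℝ (EuclideanSpace ℝ (Fin n)))
    (x₀ : EuclideanSpace ℝ (Fin n)) (T : Submodule ℝ (EuclideanSpace ℝ (Fin n))) (e : T) :
    Prop where
  subdifferential_eq :
    subdifferential N x₀ =
      {z | T.starProjection z = (e : EuclideanSpace ℝ (Fin n)) ∧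
        dualNorm N (Tᗮ.starProjection z) ≤ 1}
  isLUB_of_mem_orthogonal : ∀ w ∈ Tᗮ,
    IsLUB {r : ℝ | ∃ v ∈ Tᗮ, dualNorm N v ≤ 1 ∧ r = inner ℝ v w} (N w)

/-- A Gaussian measurement map: a random `m × n` matrix whose entries are i.i.d. centred Gaussian
variables of variance `1 / m`. -/
structure IsGaussianMeasurementMap {Ω : Type*} [MeasurableSpace Ω] (P : Measure Ω) {m n : ℕ}
    (Φ : Ω → Matrix (Fin m) (Fin n) ℝ) : Prop where
  measurable : ∀ i j, Measurable (fun ω => Φ ω i j)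
  law : ∀ i j, P.map (fun ω => Φ ω i j) = gaussianReal 0 (1 / (m : ℝ≥0))
  indep : iIndepFun (fun (p : Fin m × Fin n) ω => Φ ω p.1 p.2) P

/-- The restriction `Φ_T : T → ℝᵐ` of a matrix to a subspace. -/
def restrictTo {m n : ℕ} (A : Matrix (Fin m) (Fin n) ℝ)
    (T : Submodule ℝ (EuclideanSpace ℝ (Fin n))) : T →ₗ[ℝ] EuclideanSpace ℝ (Fin m) :=
  (Matrix.toEuclideanLin A).domRestrict T

/-- `q = Φ_T (Φ_T^* Φ_T)⁻¹ e`, the least-squares solution of `P_T (Φ^* q) = e`. (`Ring.inverse` is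
the inverse in the algebra of endomorphisms of `T`; it is `0` if `Φ_T` is not injective.) -/
def dualMultiplier {m n : ℕ} (A : Matrix (Fin m) (Fin n) ℝ)
    (T : Submodule ℝ (EuclideanSpace ℝ (Fin n))) (e : T) : EuclideanSpace ℝ (Fin m) :=
  restrictTo A T
    ((Ring.inverse ((LinearMap.adjoint (restrictTo A T)) ∘ₗ restrictTo A T : Module.End ℝ T)) e)

/-- `y = Φ^* q`. -/
def dualCertificate {m n : ℕ} (A : Matrix (Fin m) (Fin n) ℝ)
    (T : Submodule ℝ (EuclideanSpace ℝ (Fin n))) (e : T) : EuclideanSpace ℝ (Fin n) :=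
  LinearMap.adjoint (Matrix.toEuclideanLin A) (dualMultiplier A T e)

/-- `x₀` is the unique solution of: minimize `N x` subject to `A x = A x₀`. -/
def IsUniqueMinimizer {m n : ℕ} (N : Seminorm ℝ (EuclideanSpace ℝ (Fin n)))
    (A : Matrix (Fin m) (Fin n) ℝ) (x₀ : EuclideanSpace ℝ (Fin n)) : Prop :=
  {x | Matrix.toEuclideanLin A x = Matrix.toEuclideanLin A x₀ ∧
    ∀ x', Matrix.toEuclideanLin A x' = Matrix.toEuclideanLin A x₀ → N x ≤ N x'} = {x₀}

end

/-! Deterministic half: if `Φ_T` is injective, `y = Φ^* q` satisfies `P_T y = e`; if moreover the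
dual norm of `P_{T^⊥} y` is below 1, then `y` certifies unique optimality
(`isUniqueMinimizer_of_certificate`). Injectivity is almost sure, so failure is covered by the event
`B` that this dual norm is at least 1, and `P B ≤ P[B | A] + P Aᶜ`, with `A` the event that `q` is
short.

Probabilistic half: `‖e‖ / ‖q‖` is the distance from the image of `e / ‖e‖` to the span of the
images of the remaining `d_T - 1` vectors of an orthonormal basis of `T` (`exists_norm_sub_sum_lt`
uses only the bound it needs). Those images have i.i.d. Gaussian entries. With the other columns
frozen, the squared distance dominates a sum of `m - d_T + 1` squared independent Gaussians, and a
Chernoff bound controls its lower tail. -/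

/-! ### Dual norm and dual certificates. -/

theorem Seminorm.continuous_of_euclideanSpace {n : ℕ}
    (N : Seminorm ℝ (EuclideanSpace ℝ (Fin n))) : Continuous N :=
  continuousOn_univ.1 (N.convexOn.continuousOn isOpen_univ)

/-- A norm on `ℝⁿ` dominates a multiple of the Euclidean norm. -/
theorem Seminorm.exists_norm_le_mul {n : ℕ} (N : Seminorm ℝ (EuclideanSpace ℝ (Fin n)))
    (hN : ∀ x, N x = 0 → x = 0) : ∃ C : ℝ, ∀ x, ‖x‖ ≤ C * N x := by
  rcases (Metric.sphere (0 : EuclideanSpace ℝ (Fin n)) 1).eq_empty_or_nonempty with h | h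
  · refine ⟨0, fun x => ?_⟩
    by_cases hx : x = 0
    · simp [hx]
    · have : (‖x‖⁻¹ • x) ∈ Metric.sphere (0 : EuclideanSpace ℝ (Fin n)) 1 := by
        simp [norm_smul, hx]
      simp [h] at this
  · obtain ⟨z, hz, hmin⟩ := (isCompact_sphere (0 : EuclideanSpace ℝ (Fin n)) 1).exists_isMinOn h
      N.continuous_of_euclideanSpace.continuousOn
    have hz0 : z ≠ 0 := by
      rintro rfl
      simp at hz
    have hpos : 0 < N z := lt_of_le_of_ne (apply_nonneg N z) fun h0 => hz0 (hN z h0.symm)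
    refine ⟨(N z)⁻¹, fun x => ?_⟩
    by_cases hx : x = 0
    · simp [hx]
    · have hxn : 0 < ‖x‖ := norm_pos_iff.2 hx
      have hmem : (‖x‖⁻¹ • x) ∈ Metric.sphere (0 : EuclideanSpace ℝ (Fin n)) 1 := by
        simp [norm_smul, hx]
      have h1 : N z ≤ N (‖x‖⁻¹ • x) := hmin hmem
      rw [map_smul_eq_mul, norm_inv, norm_norm, inv_mul_eq_div, le_div_iff₀ hxn] at h1
      rw [inv_mul_eq_div, le_div_iff₀ hpos]
      linarith

/-- The dual-norm inequality `⟨x, a⟩ ≤ ‖x‖* ‖a‖`. -/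
theorem inner_le_dualNorm_mul {n : ℕ} (N : Seminorm ℝ (EuclideanSpace ℝ (Fin n)))
    (hN : ∀ x, N x = 0 → x = 0) (x a : EuclideanSpace ℝ (Fin n)) :
    inner ℝ x a ≤ dualNorm N x * N a := by
  by_cases ha : a = 0
  · simp [ha]
  have hpos : 0 < N a := lt_of_le_of_ne (apply_nonneg N a) fun h0 => ha (hN a h0.symm)
  obtain ⟨C, hC⟩ := N.exists_norm_le_mul hN
  have hbdd : BddAbove {r : ℝ | ∃ a : EuclideanSpace ℝ (Fin n), N a ≤ 1 ∧ r = inner ℝ x a} := by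
    refine ⟨‖x‖ * |C|, ?_⟩
    rintro r ⟨b, hb, rfl⟩
    refine (real_inner_le_norm x b).trans (mul_le_mul_of_nonneg_left ?_ (norm_nonneg _))
    calc ‖b‖ ≤ C * N b := hC b
      _ ≤ |C| * N b := mul_le_mul_of_nonneg_right (le_abs_self C) (apply_nonneg N b)
      _ ≤ |C| * 1 := mul_le_mul_of_nonneg_left hb (abs_nonneg C)
      _ = |C| := mul_one _
  have h : inner ℝ x ((N a)⁻¹ • a) ≤ dualNorm N x := by
    refine le_csSup hbdd ⟨(N a)⁻¹ • a, ?_, rfl⟩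
    rw [map_smul_eq_mul, norm_inv, Real.norm_of_nonneg hpos.le, inv_mul_cancel₀ hpos.ne']
  rwa [real_inner_smul_right, inv_mul_eq_div, div_le_iff₀ hpos] at h

/-- If `A` is injective on `T` and some `y` in the row space of `A` lies in the relative interior of
the subdifferential, then `x₀` is the unique minimizer. -/
theorem isUniqueMinimizer_of_certificate {m n : ℕ} (N : Seminorm ℝ (EuclideanSpace ℝ (Fin n)))
    (hN : ∀ x, N x = 0 → x = 0) {x₀ : EuclideanSpace ℝ (Fin n)}
    {T : Submodule ℝ (EuclideanSpace ℝ (Fin n))} {e : T} (hdec : IsDecomposableAt N x₀ T e)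
    {A : Matrix (Fin m) (Fin n) ℝ} (hinj : Function.Injective (restrictTo A T))
    (q : EuclideanSpace ℝ (Fin m))
    (hT : T.starProjection (LinearMap.adjoint (Matrix.toEuclideanLin A) q) = e)
    (hT' : dualNorm N (Tᗮ.starProjection (LinearMap.adjoint (Matrix.toEuclideanLin A) q)) < 1) :
    IsUniqueMinimizer N A x₀ := by
  set y := LinearMap.adjoint (Matrix.toEuclideanLin A) q with hy
  have key : ∀ x, Matrix.toEuclideanLin A x = Matrix.toEuclideanLin A x₀ → x ≠ x₀ →
      N x₀ < N x := by
    intro x hx hne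
    set h := x - x₀ with hh
    have hAh : Matrix.toEuclideanLin A h = 0 := by rw [hh, map_sub, hx, sub_self]
    set w := Tᗮ.starProjection h with hw
    have hwmem : w ∈ Tᗮ := Submodule.starProjection_apply_mem _ _
    have hinner : ∀ v ∈ Tᗮ, inner ℝ v h = inner ℝ v w := by
      intro v hv
      rw [hw, ← Submodule.inner_starProjection_left_eq_right,
        Submodule.starProjection_eq_self_iff.2 hv]
    -- Otherwise `h` lies in `T` and in the kernel of `A`, against injectivity.
    have hw0 : w ≠ 0 := by
      intro h0
      have hmem : h ∈ T := by
        rw [← Submodule.orthogonal_orthogonal T]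
        exact (Submodule.starProjection_apply_eq_zero_iff _).1 h0
      have : (⟨h, hmem⟩ : T) = 0 := hinj (by simpa [restrictTo] using hAh)
      exact hne (sub_eq_zero.1 (congrArg Subtype.val this))
    have hNw : 0 < N w := lt_of_le_of_ne (apply_nonneg N w) fun h0 => hw0 (hN w h0.symm)
    have hyh : inner ℝ y h = 0 := by
      rw [hy, LinearMap.adjoint_inner_left, hAh, inner_zero_right]
    have hsplit : inner ℝ (e : EuclideanSpace ℝ (Fin n)) h
        + inner ℝ (Tᗮ.starProjection y) w = 0 := by
      rw [← hinner _ (Submodule.starProjection_apply_mem _ _), ← inner_add_left, ← hT,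
        Submodule.starProjection_add_starProjection_orthogonal, hyh]
    have hle := inner_le_dualNorm_mul N hN (Tᗮ.starProjection y) w
    -- Each `e + v`, with `v ∈ Tᗮ` in the dual unit ball, is a subgradient; the supremum over `v`
    -- turns `⟨v, w⟩` into `N w`.
    have hup : N w ≤ N x - N x₀ - inner ℝ (e : EuclideanSpace ℝ (Fin n)) h := by
      refine (hdec.isLUB_of_mem_orthogonal w hwmem).2 ?_
      rintro r ⟨v, hv, hv1, rfl⟩
      have hsub : (e : EuclideanSpace ℝ (Fin n)) + v ∈ subdifferential N x₀ := by
        rw [hdec.subdifferential_eq]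
        have h1 : T.starProjection v = 0 := (Submodule.starProjection_apply_eq_zero_iff _).2 hv
        have h2 : T.starProjection (e : EuclideanSpace ℝ (Fin n)) = e :=
          Submodule.starProjection_eq_self_iff.2 e.2
        have h3 : Tᗮ.starProjection v = v := Submodule.starProjection_eq_self_iff.2 hv
        have h4 : Tᗮ.starProjection (e : EuclideanSpace ℝ (Fin n)) = 0 :=
          (Submodule.starProjection_apply_eq_zero_iff _).2
            (by rw [Submodule.orthogonal_orthogonal]; exact e.2)
        exact ⟨by rw [map_add, h1, h2, add_zero], by rwa [map_add, h3, h4, zero_add]⟩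
      have := hsub x
      rw [← hh, inner_add_left, hinner v hv] at this
      linarith
    have : dualNorm N (Tᗮ.starProjection y) * N w < 1 * N w := mul_lt_mul_of_pos_right hT' hNw
    linarith
  ext x
  simp only [Set.mem_ofPred_eq, Set.mem_singleton_iff]
  constructor
  · rintro ⟨hx, hmin⟩
    by_contra hne
    exact absurd (hmin x₀ rfl) (not_le.2 (key x hx hne))
  · rintro rfl
    refine ⟨rfl, fun x' hx' => ?_⟩
    by_cases hne : x' = x
    · rw [hne]
    · exact (key x' hx' hne).le

/-! ### The least-squares multiplier `q`. -/

/-- The normal equations hold for an injective restriction. -/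
theorem exists_dualMultiplier_eq {m n : ℕ} {A : Matrix (Fin m) (Fin n) ℝ}
    {T : Submodule ℝ (EuclideanSpace ℝ (Fin n))} (hinj : Function.Injective (restrictTo A T))
    (e : T) : ∃ w : T, dualMultiplier A T e = restrictTo A T w ∧
      LinearMap.adjoint (restrictTo A T) (restrictTo A T w) = e := by
  set R := restrictTo A T with hR
  set G : Module.End ℝ T := LinearMap.adjoint R ∘ₗ R with hG
  have hGinj : Function.Injective G := by
    rw [injective_iff_map_eq_zero]
    intro u hu
    have h0 : inner ℝ (R u) (R u) = (0 : ℝ) := by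
      rw [← LinearMap.adjoint_inner_left]
      change inner ℝ (G u) u = 0
      rw [hu, inner_zero_left]
    exact hinj (by rw [inner_self_eq_zero.1 h0, map_zero])
  have hunit : IsUnit G :=
    (Module.End.isUnit_iff G).2 ⟨hGinj, LinearMap.injective_iff_surjective.1 hGinj⟩
  refine ⟨Ring.inverse G e, rfl, ?_⟩
  change (G * Ring.inverse G) e = e
  rw [Ring.mul_inverse_cancel G hunit]
  rfl

theorem starProjection_dualCertificate {m n : ℕ} {A : Matrix (Fin m) (Fin n) ℝ}
    {T : Submodule ℝ (EuclideanSpace ℝ (Fin n))} (hinj : Function.Injective (restrictTo A T))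
    (e : T) : T.starProjection (dualCertificate A T e) = e := by
  obtain ⟨w, hq, hw⟩ := exists_dualMultiplier_eq hinj e
  refine Submodule.eq_starProjection_of_mem_of_inner_eq_zero e.2 fun u hu => ?_
  rw [inner_sub_left, sub_eq_zero, dualCertificate, LinearMap.adjoint_inner_left, hq]
  change inner ℝ (restrictTo A T w) (restrictTo A T ⟨u, hu⟩) = inner ℝ e (⟨u, hu⟩ : T)
  rw [← LinearMap.adjoint_inner_left, hw]

/-- A long multiplier forces the image of `e / ‖e‖` to be close to the span of the images of the
other vectors of an orthonormal basis of `T`. -/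
theorem exists_norm_sub_sum_lt {m n : ℕ} {ι : Type*} [Fintype ι] [DecidableEq ι]
    {A : Matrix (Fin m) (Fin n) ℝ} {T : Submodule ℝ (EuclideanSpace ℝ (Fin n))}
    (hinj : Function.Injective (restrictTo A T)) {e : T} (he : e ≠ 0)
    (b : OrthonormalBasis ι ℝ T) (i : ι) (hi : b i = ‖e‖⁻¹ • e) {c : ℝ} (hc : 0 < c)
    (hlt : c * ‖e‖ < ‖dualMultiplier A T e‖) :
    ∃ a : {j // j ≠ i} → ℝ,
      ‖restrictTo A T (b i) - ∑ j, a j • restrictTo A T (b j)‖ < c⁻¹ := by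
  obtain ⟨w, hq, hw⟩ := exists_dualMultiplier_eq hinj e
  have hen : 0 < ‖e‖ := norm_pos_iff.2 he
  have hqn : 0 < ‖dualMultiplier A T e‖ := lt_trans (by positivity) hlt
  set s := ‖dualMultiplier A T e‖ with hs
  -- With `R = Φ_T` and `q = R w`, `‖q‖² = ⟨R^* R w, w⟩ = ⟨e, w⟩`.
  have hsq : inner ℝ (b i) w = s ^ 2 / ‖e‖ := by
    rw [hi, hs, hq, ← real_inner_self_eq_norm_sq, ← LinearMap.adjoint_inner_left, hw]
    exact (real_inner_smul_left e w ‖e‖⁻¹).trans (inv_mul_eq_div _ _)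
  set α := s ^ 2 / ‖e‖ with hα
  have hα0 : 0 < α := by positivity
  have hexp : dualMultiplier A T e = α • (restrictTo A T (b i)
      - ∑ j : {j // j ≠ i}, (-(α⁻¹ * inner ℝ (b j) w)) • restrictTo A T (b j)) := by
    have h1 : w = α • b i + ∑ j : {j // j ≠ i}, inner ℝ (b j) w • b j := by
      conv_lhs => rw [← b.sum_repr' w]
      rw [Fintype.sum_eq_add_sum_subtype_ne _ i, hsq]
    rw [hq]
    conv_lhs => rw [h1]
    simp only [map_add, map_smul, map_sum, neg_smul, Finset.sum_neg_distrib, sub_neg_eq_add,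
      smul_add, Finset.smul_sum, smul_smul, mul_inv_cancel_left₀ hα0.ne']
  refine ⟨fun j => -(α⁻¹ * inner ℝ (b j) w), ?_⟩
  have hn := congrArg norm hexp
  rw [norm_smul, Real.norm_of_nonneg hα0.le, ← hs] at hn
  set z := ‖restrictTo A T (b i)
      - ∑ j : {j // j ≠ i}, (-(α⁻¹ * inner ℝ (b j) w)) • restrictTo A T (b j)‖
  -- The bracket in `hexp` is `q / α`, so its norm is `s / α`.
  have hz : z = ‖e‖ / s := by
    rw [hα] at hn
    field_simp at hn ⊢
    nlinarith
  rw [hz, div_lt_iff₀ hqn, inv_mul_eq_div, lt_div_iff₀ hc]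
  linarith

/-! ### Gaussian columns: rotation invariance, lower tails, distance to a span. -/

section GaussianColumns

variable {Ω : Type*} [MeasurableSpace Ω] {P : Measure Ω}

/-- An orthonormal linear transformation of i.i.d. centred Gaussian variables is again i.i.d. with
the same law. -/
theorem iIndepFun_gaussian_orthonormal [IsProbabilityMeasure P] {ι κ : Type*} [Fintype ι]
    [Finite κ] {X : ι → Ω → ℝ} {v : ℝ≥0} (hm : ∀ i, Measurable (X i))
    (hlaw : ∀ i, P.map (X i) = gaussianReal 0 v) (hind : iIndepFun X P) (f : κ → ι → ℝ)
    (hf : ∀ j k, j ≠ k → ∑ i, f j i * f k i = 0) (hf1 : ∀ j, ∑ i, f j i * f j i = 1) :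
    iIndepFun (fun j ω => ∑ i, f j i * X i ω) P ∧
      ∀ j, P.map (fun ω => ∑ i, f j i * X i ω) = gaussianReal 0 v := by
  classical
  have := Fintype.ofFinite κ
  have hg : ∀ i, HasGaussianLaw (X i) P := fun i => ⟨by rw [hlaw i]; infer_instance⟩
  have hX : HasGaussianLaw (fun ω i => X i ω) P := hind.hasGaussianLaw hg
  have hint : ∀ i, ∫ ω, X i ω ∂P = 0 := fun i => by
    rw [← integral_map (hm i).aemeasurable (f := fun x => x) (by fun_prop), hlaw i]
    exact integral_id_gaussianReal
  have hvar : ∀ i, Var[X i; P] = v := fun i => by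
    have := variance_map (X := id) (μ := P) (Y := X i) (by fun_prop) (hm i).aemeasurable
    rw [hlaw i, variance_id_gaussianReal] at this
    exact this.symm
  have hcovX : ∀ i i', cov[X i, X i'; P] = if i = i' then (v : ℝ) else 0 := by
    intro i i'
    split_ifs with h
    · rw [← h, covariance_self (hm i).aemeasurable, hvar]
    · exact (hind.indepFun h).covariance_eq_zero (hg i).memLp_two (hg i').memLp_two
  have hmem : ∀ (j : κ) (i : ι), MemLp (fun ω => f j i * X i ω) 2 P :=
    fun j i => (hg i).memLp_two.const_mul _
  have hcov : ∀ j k, cov[fun ω => ∑ i, f j i * X i ω, fun ω => ∑ i, f k i * X i ω; P]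
      = v * ∑ i, f j i * f k i := by
    intro j k
    rw [covariance_fun_sum_fun_sum (fun i => hmem j i) (fun i => hmem k i)]
    simp only [covariance_const_mul_left, covariance_const_mul_right, hcovX]
    rw [Finset.mul_sum]
    refine Finset.sum_congr rfl fun i _ => ?_
    simp
    ring
  let L : (ι → ℝ) →L[ℝ] (κ → ℝ) :=
    LinearMap.toContinuousLinearMap (Matrix.mulVecLin (Matrix.of f))
  -- Joint Gaussianity is what lets vanishing covariances give independence.
  have hY : HasGaussianLaw (fun ω j => ∑ i, f j i * X i ω) P := hX.map_fun L
  refine ⟨hY.iIndepFun_of_covariance_eq_zero fun j k hjk => ?_, fun j => ?_⟩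
  · rw [hcov, hf j k hjk, mul_zero]
  · have hYj : HasGaussianLaw (fun ω => ∑ i, f j i * X i ω) P :=
      HasGaussianLaw.eval (X := fun j ω => ∑ i, f j i * X i ω) hY j
    rw [hYj.map_eq_gaussianReal]
    congr 1
    · rw [integral_finsetSum _ fun i _ => (hg i).integrable.const_mul _]
      simp [integral_const_mul, hint]
    · rw [← covariance_self (by fun_prop), hcov, hf1, mul_one, Real.toNNReal_coe]

/-- The factor `exp (-s x²)` merges with the density into a Gaussian integral of rate `1 / (2v) +
s`. -/
theorem mgf_sq_gaussianReal {X : Ω → ℝ} {v : ℝ≥0} (hv : v ≠ 0) (hm : Measurable X)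
    (hlaw : P.map X = gaussianReal 0 v) {s : ℝ} (hs : 0 ≤ s) :
    mgf (fun ω => X ω ^ 2) P (-s) = (Real.sqrt (1 + 2 * s * v))⁻¹ := by
  have hv0 : (0 : ℝ) < v := by positivity
  rw [mgf, ← integral_map (φ := X) (f := fun x => Real.exp (-s * x ^ 2)) hm.aemeasurable
    (by fun_prop), hlaw, integral_gaussianReal_eq_integral_smul hv]
  have : ∀ x : ℝ, gaussianPDFReal 0 v x • Real.exp (-s * x ^ 2)
      = (Real.sqrt (2 * Real.pi * v))⁻¹ * Real.exp (-(1 / (2 * v) + s) * x ^ 2) := by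
    intro x
    rw [gaussianPDFReal, smul_eq_mul, mul_assoc, ← Real.exp_add]
    congr 2
    field_simp
    ring
  simp_rw [this]
  rw [integral_const_mul, integral_gaussian, ← Real.sqrt_inv, ← Real.sqrt_inv, ← Real.sqrt_mul
    (by positivity)]
  congr 1
  field_simp

/-- Chernoff bound for the lower tail of a sum of squares of i.i.d. centred Gaussians. -/
theorem measureReal_sum_sq_le [IsProbabilityMeasure P] {k : ℕ} {Y : Fin k → Ω → ℝ} {v : ℝ≥0}
    (hv : v ≠ 0) (hm : ∀ i, Measurable (Y i)) (hlaw : ∀ i, P.map (Y i) = gaussianReal 0 v)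
    (hind : iIndepFun Y P) {s : ℝ} (hs : 0 ≤ s) (ρ : ℝ) :
    P.real {ω | ∑ i, Y i ω ^ 2 ≤ ρ} ≤ Real.exp (s * ρ) * ((Real.sqrt (1 + 2 * s * v))⁻¹) ^ k := by
  have hint : Integrable (fun ω => Real.exp (-s * ∑ i, Y i ω ^ 2)) P := by
    refine Integrable.of_bound (C := 1) (by fun_prop) (ae_of_all _ fun ω => ?_)
    rw [Real.norm_of_nonneg (Real.exp_pos _).le, Real.exp_le_one_iff]
    have : 0 ≤ ∑ i, Y i ω ^ 2 := Finset.sum_nonneg fun i _ => sq_nonneg _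
    nlinarith
  have h := measure_le_le_exp_mul_mgf (μ := P) (X := fun ω => ∑ i, Y i ω ^ 2) ρ
    (neg_nonpos.2 hs) hint
  have hind' : iIndepFun (fun i ω => Y i ω ^ 2) P :=
    hind.comp (fun _ x => x ^ 2) fun _ => by fun_prop
  have hmgf := hind'.mgf_sum (t := -s) (fun i => by fun_prop) Finset.univ
  have hfun : (∑ i, fun ω => Y i ω ^ 2) = fun ω => ∑ i, Y i ω ^ 2 := by
    ext ω
    simp
  rw [hfun] at hmgf
  rw [hmgf, neg_neg] at h
  simpa [mgf_sq_gaussianReal hv (hm _) (hlaw _) hs] using h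

/-- With `u = t / κ`, the bound `log (1 + u) ≥ u - u² / 2` reduces the exponent `κ (u - u²) / 2 - κ
log (1 + u) / 2` to `-κ u² / 4`. -/
theorem exp_mul_inv_sqrt_pow_le {k : ℕ} {κ t : ℝ} (hk : (k : ℝ) = κ) (hκ : 0 < κ) (ht : 0 ≤ t) :
    Real.exp (t / (2 * κ) * (κ - t)) * ((Real.sqrt (1 + t / κ))⁻¹) ^ k
      ≤ Real.exp (-((t ^ 2 / 4) / κ)) := by
  set u := t / κ with hu
  have hu0 : 0 ≤ u := by positivity
  have hlog : u - u ^ 2 / 2 ≤ Real.log (1 + u) := by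
    refine le_trans ?_ (Real.le_log_one_add_of_nonneg hu0)
    rw [le_div_iff₀ (by positivity)]
    nlinarith [pow_nonneg hu0 3]
  have hrt : (Real.sqrt (1 + u))⁻¹ = Real.exp (-(Real.log (1 + u) / 2)) := by
    rw [Real.exp_neg, Real.sqrt_eq_rpow, Real.rpow_def_of_pos (by positivity)]
    congr 2
    ring
  rw [hrt, ← Real.exp_nat_mul, ← Real.exp_add, hk, Real.exp_le_exp]
  have h1 : κ * (u - u ^ 2 / 2) ≤ κ * Real.log (1 + u) := mul_le_mul_of_nonneg_left hlog hκ.le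
  have h2 : t = κ * u := by rw [hu]; field_simp
  rw [h2]
  have h3 : κ * u / (2 * κ) * (κ - κ * u) = κ * (u - u ^ 2) / 2 := by field_simp
  have h4 : (κ * u) ^ 2 / 4 / κ = κ * u ^ 2 / 4 := by field_simp
  rw [h3, h4]
  nlinarith

/-- A Gaussian vector is unlikely to be close to a fixed subspace. -/
theorem measureReal_near_submodule_le [IsProbabilityMeasure P] {m k : ℕ} {X : Fin m → Ω → ℝ}
    {v : ℝ≥0} (hv : v ≠ 0) (hm : ∀ i, Measurable (X i))
    (hlaw : ∀ i, P.map (X i) = gaussianReal 0 v) (hind : iIndepFun X P)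
    (V : Submodule ℝ (EuclideanSpace ℝ (Fin m))) (hV : Module.finrank ℝ V + k ≤ m)
    {s : ℝ} (hs : 0 ≤ s) (r : ℝ) :
    P.real {ω | ∃ z ∈ V, ‖WithLp.toLp 2 (fun i => X i ω) - z‖ < r}
      ≤ Real.exp (s * r ^ 2) * ((Real.sqrt (1 + 2 * s * v))⁻¹) ^ k := by
  have hdim : k ≤ Module.finrank ℝ Vᗮ := by
    have := V.finrank_add_finrank_orthogonal
    rw [finrank_euclideanSpace_fin] at this
    omega
  let b := stdOrthonormalBasis ℝ Vᗮ
  let f : Fin k → EuclideanSpace ℝ (Fin m) := fun j => b (Fin.castLE hdim j)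
  have hfmem : ∀ j, f j ∈ Vᗮ := fun j => (b _).2
  have hfo : Orthonormal ℝ f :=
    (b.orthonormal.comp_linearIsometry Vᗮ.subtypeₗᵢ).comp _ (Fin.castLE_injective hdim)
  have hinner : ∀ x y : EuclideanSpace ℝ (Fin m), inner ℝ x y = ∑ i, x i * y i := fun x y => by
    simp [PiLp.inner_apply, mul_comm]
  obtain ⟨hYind, hYlaw⟩ := iIndepFun_gaussian_orthonormal hm hlaw hind (fun j i => f j i)
    (fun j l hjl => by rw [← hinner]; exact hfo.2 hjl)
    (fun j => by rw [← hinner, real_inner_self_eq_norm_sq, hfo.1 j, one_pow])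
  refine le_trans (measureReal_mono ?_) (measureReal_sum_sq_le hv (fun j => by fun_prop) hYlaw
    hYind hs (r ^ 2))
  rintro ω ⟨z, hz, hlt⟩
  -- Bessel's inequality for `k` orthonormal vectors of `Vᗮ`, to which `z` contributes nothing.
  have hB := hfo.sum_inner_products_le (s := Finset.univ)
    (WithLp.toLp 2 (fun i => X i ω) - z)
  have hle : ‖WithLp.toLp 2 (fun i => X i ω) - z‖ ^ 2 ≤ r ^ 2 :=
    pow_le_pow_left₀ (norm_nonneg _) hlt.le 2
  refine le_trans (le_of_eq ?_) (hB.trans hle)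
  refine Finset.sum_congr rfl fun j _ => ?_
  rw [inner_sub_right, Submodule.inner_left_of_mem_orthogonal hz (hfmem j), sub_zero, hinner,
    Real.norm_eq_abs, sq_abs]

/-- A random variable independent of `B` meets a `B`-dependent event with probability at most the
supremum over frozen values of `B`. -/
theorem measure_pair_mem_le [IsProbabilityMeasure P] {α β : Type*} [MeasurableSpace α]
    [MeasurableSpace β] {A : Ω → α} {B : Ω → β} (hA : Measurable A) (hB : Measurable B)
    (hind : IndepFun A B P) {D : Set (α × β)} (hD : MeasurableSet D) {c : ℝ≥0∞}
    (hc : ∀ w, P {ω | (A ω, w) ∈ D} ≤ c) : P {ω | (A ω, B ω) ∈ D} ≤ c := by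
  have hpA := P.isProbabilityMeasure_map hA.aemeasurable
  have hpB := P.isProbabilityMeasure_map hB.aemeasurable
  have h1 : P {ω | (A ω, B ω) ∈ D} = (P.map fun ω => (A ω, B ω)) D :=
    (Measure.map_apply (hA.prodMk hB) hD).symm
  rw [h1, (indepFun_iff_map_prod_eq_prod_map_map hA.aemeasurable hB.aemeasurable).1 hind,
    Measure.prod_apply_symm hD]
  calc ∫⁻ w, P.map A ((fun x => (x, w)) ⁻¹' D) ∂P.map B
      ≤ ∫⁻ _, c ∂P.map B := lintegral_mono fun w => by
        rw [Measure.map_apply hA (hD.preimage (by fun_prop))]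
        exact hc w
    _ = c := by simp

/-- One column of a Gaussian matrix is unlikely to be close to the span of the others. -/
theorem measureReal_near_span_le [IsProbabilityMeasure P] {m k : ℕ} {ι : Type*} [Fintype ι]
    [DecidableEq ι] {Y : Fin m × ι → Ω → ℝ} {v : ℝ≥0} (hv : v ≠ 0) (hm : ∀ p, Measurable (Y p))
    (hlaw : ∀ p, P.map (Y p) = gaussianReal 0 v) (hind : iIndepFun Y P) (i : ι)
    (hk : Fintype.card ι + k = m + 1) {s : ℝ} (hs : 0 ≤ s) (r : ℝ) :
    P.real {ω | ∃ a : {j // j ≠ i} → ℝ, ‖WithLp.toLp 2 (fun l => Y (l, i) ω)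
        - ∑ j : {j // j ≠ i}, a j • WithLp.toLp 2 (fun l => Y (l, j) ω)‖ < r}
      ≤ Real.exp (s * r ^ 2) * ((Real.sqrt (1 + 2 * s * v))⁻¹) ^ k := by
  let E := EuclideanSpace ℝ (Fin m)
  let A : Ω → E := fun ω => WithLp.toLp 2 (fun l => Y (l, i) ω)
  let B : Ω → ({j // j ≠ i} → E) := fun ω j => WithLp.toLp 2 (fun l => Y (l, j) ω)
  let D : Set (E × ({j // j ≠ i} → E)) := {p | ∃ a : {j // j ≠ i} → ℝ, ‖p.1 - ∑ j, a j • p.2 j‖ < r}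
  -- A union of open sets over `a`: this gives measurability despite the uncountable quantifier.
  have hD : IsOpen D := by
    have : D = ⋃ a : {j // j ≠ i} → ℝ, {p | ‖p.1 - ∑ j, a j • p.2 j‖ < r} := by
      ext p
      simp [D]
    rw [this]
    exact isOpen_iUnion fun a => isOpen_lt (by fun_prop) continuous_const
  have hA : Measurable A := by fun_prop
  have hB : Measurable B := by fun_prop
  have hAB : IndepFun A B P := by
    let S : Finset (Fin m × ι) := Finset.univ.filter fun p => p.2 = i
    let S' : Finset (Fin m × ι) := Finset.univ.filter fun p => p.2 ≠ i
    have hdisj : Disjoint S S' := Finset.disjoint_filter_filter_not _ _ _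
    let φ : (S → ℝ) → E := fun x => WithLp.toLp 2 (fun l => x ⟨(l, i), by simp [S]⟩)
    let ψ : (S' → ℝ) → ({j // j ≠ i} → E) := fun x j =>
      WithLp.toLp 2 (fun l => x ⟨(l, j), by simpa [S'] using j.2⟩)
    have hφ : Measurable φ := by fun_prop
    have hψ : Measurable ψ := by fun_prop
    exact (hind.indepFun_finset S S' hdisj hm).comp hφ hψ
  have hmain := measure_pair_mem_le hA hB hAB hD.measurableSet
    (c := ENNReal.ofReal (Real.exp (s * r ^ 2) * ((Real.sqrt (1 + 2 * s * v))⁻¹) ^ k)) ?_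
  · exact ENNReal.toReal_le_of_le_ofReal (by positivity) hmain
  · intro w
    let V : Submodule ℝ E := Submodule.span ℝ (Set.range w)
    -- Only `card ι - 1` columns span `V`; this is the `+ 1` in `m - d_T + 1`.
    have hV : Module.finrank ℝ V + k ≤ m := by
      have h1 : Module.finrank ℝ V ≤ Fintype.card {j // j ≠ i} := finrank_range_le_card w
      have h2 : Fintype.card {j // j ≠ i} = Fintype.card ι - 1 := by
        simp
      have h3 : 0 < Fintype.card ι := Fintype.card_pos_iff.2 ⟨i⟩
      omega
    have h := measureReal_near_submodule_le hv (fun l => hm (l, i)) (fun l => hlaw (l, i))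
      (hind.precomp (g := fun l : Fin m => (l, i)) fun _ _ h => (Prod.ext_iff.1 h).1) V hV hs r
    rw [← ofReal_measureReal]
    refine ENNReal.ofReal_le_ofReal (le_trans (measureReal_mono ?_) h)
    rintro ω ⟨a, ha⟩
    exact ⟨∑ j, a j • w j, Submodule.sum_mem _ fun j _ =>
      Submodule.smul_mem _ _ (Submodule.subset_span ⟨j, rfl⟩), ha⟩

/-- The columns of a Gaussian matrix with at least as many rows as columns are almost surely
linearly independent. -/
theorem ae_linearIndependent_columns [IsProbabilityMeasure P] {m : ℕ} {ι : Type*} [Fintype ι]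
    [DecidableEq ι] {Y : Fin m × ι → Ω → ℝ} {v : ℝ≥0} (hv : v ≠ 0) (hm : ∀ p, Measurable (Y p))
    (hlaw : ∀ p, P.map (Y p) = gaussianReal 0 v) (hind : iIndepFun Y P)
    (hcard : Fintype.card ι ≤ m) :
    ∀ᵐ ω ∂P, LinearIndependent ℝ
      fun j => (WithLp.toLp 2 (fun l => Y (l, j) ω) : EuclideanSpace ℝ (Fin m)) := by
  have hv0 : (0 : ℝ) < v := by positivity
  simp_rw [linearIndependent_iff_notMem_span]
  rw [ae_all_iff]
  intro i
  rw [ae_iff, ← measureReal_eq_zero_iff]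
  refine le_antisymm ?_ measureReal_nonneg
  obtain ⟨k, hk⟩ : ∃ k, m = Fintype.card ι + k := Nat.exists_eq_add_of_le hcard
  have hb : ∀ x : ℝ, 0 < x → P.real {ω | ¬ (WithLp.toLp 2 (fun l => Y (l, i) ω) :
      EuclideanSpace ℝ (Fin m)) ∉ Submodule.span ℝ ((fun j => (WithLp.toLp 2 (fun l => Y (l, j) ω) :
      EuclideanSpace ℝ (Fin m))) '' (Set.univ \ {i}))} ≤
      Real.exp 1 * ((Real.sqrt (1 + 2 * x * v))⁻¹) ^ (k + 1) := by
    intro x hx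
    -- Radius `x^(-1/2)` and Chernoff parameter `x` keep the exponential factor at `exp 1`, while
    -- the power tends to 0 as `x → ∞`.
    have h := measureReal_near_span_le (P := P) hv hm hlaw hind i (k := k + 1) (by omega) hx.le
      (Real.sqrt x⁻¹)
    rw [Real.sq_sqrt (by positivity), mul_inv_cancel₀ hx.ne'] at h
    refine le_trans (measureReal_mono ?_) h
    intro ω hω
    rw [Set.mem_ofPred_eq, not_not, show (Set.univ \ {i} : Set ι) = {j | j ≠ i} by ext; simp,
      Set.image_eq_range, Submodule.mem_span_range_iff_exists_fun] at hω
    obtain ⟨a, ha⟩ := hω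
    refine ⟨a, ?_⟩
    change ‖_ - ∑ j : {j | j ≠ i}, _‖ < _
    rw [← ha]
    simpa using hx
  refine ge_of_tendsto (x := Filter.atTop) (f := fun x : ℝ =>
    Real.exp 1 * ((Real.sqrt (1 + 2 * x * v))⁻¹) ^ (k + 1)) ?_
    ((Filter.eventually_gt_atTop 0).mono hb)
  have h1 : Filter.Tendsto (fun x : ℝ => 1 + 2 * x * v) Filter.atTop Filter.atTop :=
    Filter.tendsto_atTop_add_const_left _ _
      ((Filter.tendsto_id.const_mul_atTop two_pos).atTop_mul_const hv0)
  have h2 := ((Real.tendsto_sqrt_atTop.comp h1).inv_tendsto_atTop.pow (k + 1)).const_mul (Real.exp 1)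
  simpa using h2

end GaussianColumns

/-! ### The restricted Gaussian map and the length of `q`. -/

/-- The entries of the images of an orthonormal basis of `T` under a Gaussian measurement map are
i.i.d. Gaussian variables. -/
theorem IsGaussianMeasurementMap.iIndepFun_restrictTo {Ω : Type*} [MeasurableSpace Ω]
    {P : Measure Ω} [IsProbabilityMeasure P] {m n : ℕ} {Φ : Ω → Matrix (Fin m) (Fin n) ℝ}
    (hΦ : IsGaussianMeasurementMap P Φ) {T : Submodule ℝ (EuclideanSpace ℝ (Fin n))} {ι : Type*}
    [Fintype ι] (b : OrthonormalBasis ι ℝ T) :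
    (∀ p : Fin m × ι, Measurable fun ω => restrictTo (Φ ω) T (b p.2) p.1) ∧
    iIndepFun (fun (p : Fin m × ι) ω => restrictTo (Φ ω) T (b p.2) p.1) P ∧
      ∀ p : Fin m × ι, P.map (fun ω => restrictTo (Φ ω) T (b p.2) p.1)
        = gaussianReal 0 (1 / (m : ℝ≥0)) := by
  classical
  let f : Fin m × ι → Fin m × Fin n → ℝ := fun p q =>
    if q.1 = p.1 then (b p.2 : EuclideanSpace ℝ (Fin n)) q.2 else 0
  have hentry : ∀ (p : Fin m × ι) ω,
      ∑ q, f p q * Φ ω q.1 q.2 = restrictTo (Φ ω) T (b p.2) p.1 := by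
    intro p ω
    rw [Fintype.sum_prod_type, Finset.sum_eq_single p.1 (by intro l _ hl; simp [f, hl]) (by simp)]
    simp [f, restrictTo, Matrix.toLpLin_apply, Matrix.mulVec, dotProduct, mul_comm]
  have hsum : ∀ p p' : Fin m × ι, ∑ q, f p q * f p' q
      = if p.1 = p'.1 then inner ℝ (b p.2) (b p'.2) else 0 := by
    intro p p'
    rw [Fintype.sum_prod_type, Finset.sum_eq_single p.1 (by intro l _ hl; simp [f, hl]) (by simp)]
    split_ifs with h
    · rw [Submodule.coe_inner]
      simp [f, h, PiLp.inner_apply, mul_comm]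
    · simp [f, h]
  have h := iIndepFun_gaussian_orthonormal (P := P)
    (X := fun (q : Fin m × Fin n) ω => Φ ω q.1 q.2) (v := 1 / (m : ℝ≥0))
    (fun q => hΦ.measurable q.1 q.2) (fun q => hΦ.law q.1 q.2) hΦ.indep f
    (fun p p' hpp => by
      rw [hsum]
      split_ifs with h1
      · exact b.orthonormal.2 fun h2 => hpp (Prod.ext h1 h2)
      · rfl)
    (fun p => by rw [hsum, if_pos rfl, b.inner_eq_one])
  simp only [hentry] at h
  refine ⟨fun p => ?_, h⟩
  simp only [← hentry]
  exact Finset.measurable_sum _ fun q _ => (hΦ.measurable q.1 q.2).const_mul _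

theorem IsGaussianMeasurementMap.ae_injective_restrictTo {Ω : Type*} [MeasurableSpace Ω]
    {P : Measure Ω} [IsProbabilityMeasure P] {m n : ℕ} {Φ : Ω → Matrix (Fin m) (Fin n) ℝ}
    (hΦ : IsGaussianMeasurementMap P Φ) {T : Submodule ℝ (EuclideanSpace ℝ (Fin n))}
    (hT : Module.finrank ℝ T ≤ m) : ∀ᵐ ω ∂P, Function.Injective (restrictTo (Φ ω) T) := by
  -- For `m = 0` the variance `1 / m` is 0 by convention, but then `T` is trivial.
  rcases Nat.eq_zero_or_pos m with rfl | hmpos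
  · have : Subsingleton T := Module.finrank_zero_iff.1 (Nat.le_zero.1 hT)
    exact ae_of_all _ fun ω => Function.injective_of_subsingleton _
  · let b := stdOrthonormalBasis ℝ T
    obtain ⟨hm, hind, hlaw⟩ := hΦ.iIndepFun_restrictTo b
    have hv : (1 / (m : ℝ≥0)) ≠ 0 := by positivity
    filter_upwards [ae_linearIndependent_columns hv hm hlaw hind (by simpa using hT)] with ω hω
    refine (injective_iff_map_eq_zero _).2 fun w hw => ?_
    rw [← b.sum_repr w, map_sum] at hw
    simp only [map_smul] at hw
    have h0 := Fintype.linearIndependent_iff.1 hω (fun j => b.repr w j) hw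
    rw [← b.sum_repr w]
    exact Finset.sum_eq_zero fun j _ => by rw [h0 j, zero_smul]

/-- The multiplier `q` exceeds its typical length with exponentially small probability. -/
theorem IsGaussianMeasurementMap.measureReal_lt_norm_dualMultiplier_le {Ω : Type*}
    [MeasurableSpace Ω] {P : Measure Ω} [IsProbabilityMeasure P] {m n : ℕ}
    {Φ : Ω → Matrix (Fin m) (Fin n) ℝ} (hΦ : IsGaussianMeasurementMap P Φ)
    {T : Submodule ℝ (EuclideanSpace ℝ (Fin n))} (e : T) {t : ℝ} (ht : 0 < t)
    (htm : t < (m : ℝ) - Module.finrank ℝ T + 1) :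
    P.real {ω | Real.sqrt ((m : ℝ) / ((m : ℝ) - Module.finrank ℝ T + 1 - t)) * ‖e‖
        < ‖dualMultiplier (Φ ω) T e‖}
      ≤ Real.exp (-((t ^ 2 / 4) / ((m : ℝ) - Module.finrank ℝ T + 1))) := by
  classical
  by_cases he : e = 0
  · simp [he, dualMultiplier, Real.exp_nonneg]
  have hdm : Module.finrank ℝ T ≤ m := by
    have : (Module.finrank ℝ T : ℝ) < m + 1 := by linarith
    exact Nat.lt_succ_iff.1 (by exact_mod_cast this)
  have : Nontrivial T := ⟨e, 0, he⟩
  have hd : 0 < Module.finrank ℝ T := Module.finrank_pos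
  have hmpos : 0 < m := hd.trans_le hdm
  have hmR : (0 : ℝ) < m := by exact_mod_cast hmpos
  set κ := (m : ℝ) - Module.finrank ℝ T + 1 with hκ
  set d := Module.finrank ℝ T with hd'
  obtain ⟨k, hk⟩ : ∃ k, m + 1 = d + k := Nat.exists_eq_add_of_le (by omega)
  have hkκ : (k : ℝ) = κ := by
    have : (m : ℝ) + 1 = d + k := by exact_mod_cast hk
    rw [hκ]
    linarith
  have hκ0 : 0 < κ := ht.trans htm
  have hκt : 0 < κ - t := sub_pos.2 htm
  let i : Fin d := ⟨0, hd⟩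
  have hon : Orthonormal ℝ (({i} : Set (Fin d)).domRestrict fun _ => ‖e‖⁻¹ • e) := by
    refine ⟨fun _ => ?_, fun x y hxy => absurd (Subsingleton.elim x y) hxy⟩
    exact norm_smul_inv_norm (𝕜 := ℝ) he
  obtain ⟨b, hb⟩ := hon.exists_orthonormalBasis_extension_of_card_eq (by simp [hd'])
  have hbi := hb i rfl
  obtain ⟨hm, hind, hlaw⟩ := hΦ.iIndepFun_restrictTo b
  have hv : (1 / (m : ℝ≥0)) ≠ 0 := by positivity
  set c := Real.sqrt ((m : ℝ) / (κ - t)) with hc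
  have hc0 : 0 < c := Real.sqrt_pos.2 (by positivity)
  -- The Chernoff parameter `m t / (2κ)` makes `1 + 2 s / m = 1 + t / κ`; it is simpler than the
  -- optimal one and suffices.
  have hs : 0 ≤ m * (t / (2 * κ)) := by positivity
  have hmain := measureReal_near_span_le (P := P) hv hm hlaw hind i (k := k)
    (by simpa using hk.symm) hs c⁻¹
  have hr : m * (t / (2 * κ)) * c⁻¹ ^ 2 = t / (2 * κ) * (κ - t) := by
    rw [inv_pow, hc, Real.sq_sqrt (by positivity)]
    field_simp
  have hu : 1 + 2 * (m * (t / (2 * κ))) * ((1 / (m : ℝ≥0) : ℝ≥0) : ℝ) = 1 + t / κ := by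
    push_cast
    field_simp
  rw [hr, hu] at hmain
  refine le_trans ?_ (hmain.trans (exp_mul_inv_sqrt_pow_le hkκ hκ0 ht.le))
  refine ENNReal.toReal_mono (measure_ne_top _ _) (measure_mono_ae ?_)
  filter_upwards [hΦ.ae_injective_restrictTo hdm] with ω hinj hω
  exact exists_norm_sub_sum_lt hinj he b i hbi hc0 hω

/-! ### Conditioning and conclusion. -/

/-- Dividing by `P A ≤ 1` only increases `P (B ∩ A)`. Subadditivity suffices, so `A` and `B` may be
non-measurable. -/
theorem measureReal_le_cond_add {Ω : Type*} [MeasurableSpace Ω] (P : Measure Ω)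
    [IsProbabilityMeasure P] (A B : Set Ω) : P.real B ≤ (P[|A]).real B + P.real Aᶜ := by
  have h1 : P (B ∩ A) ≤ (P[|A]) B := by
    rw [ProbabilityTheory.cond, Measure.smul_apply, smul_eq_mul]
    calc P (B ∩ A) ≤ P.restrict A B := Measure.le_restrict_apply A B
      _ = 1 * P.restrict A B := (one_mul _).symm
      _ ≤ (P A)⁻¹ * P.restrict A B := by
        gcongr
        exact ENNReal.one_le_inv.2 prob_le_one
  calc P.real B ≤ P.real ((B ∩ A) ∪ Aᶜ) :=
        measureReal_mono fun x hx => by by_cases h : x ∈ A <;> simp [h, hx]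
    _ ≤ P.real (B ∩ A) + P.real Aᶜ := measureReal_union_le _ _
    _ ≤ (P[|A]).real B + P.real Aᶜ :=
        add_le_add_left (ENNReal.toReal_mono (measure_ne_top _ _) h1) _

theorem proposition1 {Ω : Type*} [MeasurableSpace Ω] (P : Measure Ω) [IsProbabilityMeasure P]
    {m n : ℕ} (N : Seminorm ℝ (EuclideanSpace ℝ (Fin n))) (hN : ∀ x, N x = 0 → x = 0)
    (x₀ : EuclideanSpace ℝ (Fin n)) (T : Submodule ℝ (EuclideanSpace ℝ (Fin n))) (e : T)
    (hdec : IsDecomposableAt N x₀ T e)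
    (Φ : Ω → Matrix (Fin m) (Fin n) ℝ) (hΦ : IsGaussianMeasurementMap P Φ)
    (t : ℝ) (ht : 0 < t) (htm : t < (m : ℝ) - Module.finrank ℝ T + 1) :
    1 - (P[|{ω | ‖dualMultiplier (Φ ω) T e‖ ≤
            Real.sqrt ((m : ℝ) / ((m : ℝ) - Module.finrank ℝ T + 1 - t)) * ‖e‖}]).real
          {ω | 1 ≤ dualNorm N (Tᗮ.starProjection (dualCertificate (Φ ω) T e))}
        - Real.exp (-((t ^ 2 / 4) / ((m : ℝ) - Module.finrank ℝ T + 1)))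
      ≤ P.real {ω | IsUniqueMinimizer N (Φ ω) x₀} := by
  have hdm : Module.finrank ℝ T ≤ m := by
    have : (Module.finrank ℝ T : ℝ) < m + 1 := by linarith
    exact Nat.lt_succ_iff.1 (by exact_mod_cast this)
  set A := {ω | ‖dualMultiplier (Φ ω) T e‖ ≤
    Real.sqrt ((m : ℝ) / ((m : ℝ) - Module.finrank ℝ T + 1 - t)) * ‖e‖} with hA
  set B := {ω | 1 ≤ dualNorm N (Tᗮ.starProjection (dualCertificate (Φ ω) T e))} with hB
  set U := {ω | IsUniqueMinimizer N (Φ ω) x₀} with hU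
  have hUB : P.real Uᶜ ≤ P.real B := by
    refine ENNReal.toReal_mono (measure_ne_top _ _) (measure_mono_ae ?_)
    filter_upwards [hΦ.ae_injective_restrictTo hdm] with ω hinj hω
    by_contra hωB
    exact hω (isUniqueMinimizer_of_certificate N hN hdec hinj (dualMultiplier (Φ ω) T e)
      (starProjection_dualCertificate hinj e) (not_le.1 hωB))
  have hAc : Aᶜ = {ω | Real.sqrt ((m : ℝ) / ((m : ℝ) - Module.finrank ℝ T + 1 - t)) * ‖e‖
      < ‖dualMultiplier (Φ ω) T e‖} := by
    ext ω
    simp [hA]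
  have h1 := measureReal_le_cond_add P A B
  have h2 := hΦ.measureReal_lt_norm_dualMultiplier_le e ht htm
  rw [← hAc] at h2
  -- An inequality is enough here, so measurability of `U` is not needed.
  have h3 : 1 ≤ P.real U + P.real Uᶜ := by
    rw [← probReal_univ (μ := P), ← Set.union_compl_self U]
    exact measureReal_union_le _ _
  linarith
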